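/- Let $G$ be a finite simple graph with vertex set $V(G)$ and edge set $E(G)$. Let $P(G)$ be the set of all functions (valuations) $f:E(G)\to(0,\infty)$ with $\sum_{e\in E(G)}f(e)=|E(G)|$. Let $T(G)$ be the set of all $f\in P(G)$ with $\sum_{e\ni v}f(e)=\deg v$ for every $v\in V(G)$, and let $C(G)$ be the set of all $f\in P(G)$ for which there is $g:V(G)\to(0,\infty)$ with $f(vw)=g(v)+g(w)$ for every edge $vw$. For $f\in P(G)$ put $$\tau(G)_f=\sum_{S}\ \prod_{k\in E(S)}f(k),$$ where $S$ runs over all spanning trees of $G$, and for $e\in E(G)$ let $$\tau(e)=\frac{\partial\tau(G)_f}{\partial f(e)}=\sum_{S\,:\,e\in E(S)}\ \prod_{k\in E(S),\,k\neq e}f(k).$$ Then: (1) A valuation $f\in T(G)$ maximizes $\tau(G)_f$ over $T(G)$ if and only if there are constants $\lambda_v\in\mathbb{R}$, $v\in V(G)$, such that $\tau(e)=\lambda_v+\lambda_w$ for every edge $e=vw$ of $G$. (2) A valuation $f\in C(G)$ maximizes $\tau(G)_f$ over $C(G)$ if and only if for all vertices $v,w\in V(G)$ $$\deg w\sum_{e\ni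 v}\tau(e)=\deg v\sum_{e\ni w}\tau(e).$$ -/

import Mathlib

namespace EdgeValuation

variable {V : Type*} [Fintype V] [DecidableEq V] (G : SimpleGraph V) [DecidableRel G.Adj]

/-- The set `P(G)` of positive edge valuations of total weight `|E(G)|`. -/
def P : Set (G.edgeSet → ℝ) :=
  {f | (∀ e, 0 < f e) ∧ ∑ e, f e = (G.edgeFinset.card : ℝ)}

/-- The set `T(G)` of valuations in `P(G)` for which, at each vertex, the weights of the
incident edges add up to the degree of the vertex. -/
def T : Set (G.edgeSet → ℝ) :=
  {f | f ∈ P G ∧ ∀ v : V, ∑ e : G.edgeSet with v ∈ e.1, f e = (G.degree v : ℝ)}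

/-- The set `C(G)` of valuations in `P(G)` induced by a positive function on the vertices. -/
def C : Set (G.edgeSet → ℝ) :=
  {f | f ∈ P G ∧ ∃ g : V → ℝ, (∀ v, 0 < g v) ∧
    ∀ (v w : V) (h : G.Adj v w), f ⟨s(v, w), h⟩ = g v + g w}

open Classical in
/-- The finite set of spanning trees of `G`: subgraphs on the whole vertex set which are trees. -/
noncomputable def spanningTrees : Finset (SimpleGraph V) :=
  {S : SimpleGraph V | S ≤ G ∧ S.IsTree}

open Classical in
/-- The weighted number of spanning trees `τ(G)_f`, the sum over all spanning trees of the
product of the weights of their edges. -/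
noncomputable def treeNumber (f : G.edgeSet → ℝ) : ℝ :=
  ∑ S ∈ spanningTrees G, ∏ e : G.edgeSet with e.1 ∈ S.edgeSet, f e

open Classical in
/-- The quantity `τ(e)` at `f`, which is the partial derivative of `treeNumber G` in the
coordinate `e`: the sum over all spanning trees containing `e` of the product of the weights of
their edges other than `e`. -/
noncomputable def edgeTreeNumber (f : G.edgeSet → ℝ) (e : G.edgeSet) : ℝ :=
  ∑ S ∈ spanningTrees G with e.1 ∈ S.edgeSet,
    ∏ k : G.edgeSet with k.1 ∈ S.edgeSet ∧ k ≠ e, f k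

end EdgeValuation

/-!
By the matrix-tree theorem, `τ(G)_f` is the determinant of a reduced weighted Laplacian, a positive
semidefinite matrix which depends linearly on `f`. For `A` positive definite and `X` positive
semidefinite, `x ≤ exp (x - 1)`, applied to the eigenvalues of a matrix congruent to `A⁻¹ X`, gives
`det X ≤ det A * exp (tr (A⁻¹ (X - A)))`, and by Jacobi's formula the exponent is the directional
derivative of `log det` at `A` towards `X`. So on a set of positive valuations which is relatively
open in an affine subspace, the maxima of `τ(G)_f` are exactly the points where the vector
`(τ(e))_e` is orthogonal to the direction space. With `B` the unoriented incidence matrix, this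
space is `ker B` for `T(G)`, whose orthogonal complement is the row space of `B`; for `C(G)` it
consists of the vectors `a B` with `a` orthogonal to the degree vector.
-/

namespace EdgeValuation

open Matrix Topology

/-! ### Determinants -/

section Determinants

open scoped Polynomial in
/-- The **Cauchy–Binet formula** for `A * B`, in terms of principal minors of `B * A`. -/
theorem det_mul_eq_sum_det_submatrix {m n R : Type*} [CommRing R] [Fintype m] [DecidableEq m]
    [Fintype n] [DecidableEq n] (A : Matrix m n R) (B : Matrix n m R) :
    (A * B).det = ∑ s ∈ Finset.univ.powersetCard (Fintype.card m),
      ((B * A).submatrix (Subtype.val : s → n) (Subtype.val : s → n)).det := by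
  -- Compare the coefficients of `X ^ |m|` in `det (1 + X A B) = det (1 + X B A)`.
  have hdet : (1 + (Polynomial.X : R[X]) • (A * B).map Polynomial.C).det =
      (1 + (Polynomial.X : R[X]) • (B * A).map Polynomial.C).det := by
    rw [Matrix.map_mul, Matrix.map_mul, ← Matrix.smul_mul, det_one_add_mul_comm, Matrix.mul_smul]
  have htop := coeff_det_one_add_X_smul_eq_sum_minors (A * B) (Fintype.card m)
  rw [← Finset.card_univ, Finset.powersetCard_self, Finset.sum_singleton, Finset.card_univ] at htop
  rw [← coeff_det_one_add_X_smul_eq_sum_minors, ← hdet, htop]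
  exact (det_submatrix_equiv_self (Equiv.subtypeUnivEquiv Finset.mem_univ) (A * B)).symm

variable {n : Type*} [Fintype n] [DecidableEq n]

theorem hasDerivAt_det_one_add_smul {𝕜 : Type*} [NontriviallyNormedField 𝕜] (M : Matrix n n 𝕜) :
    HasDerivAt (fun t : 𝕜 => (1 + t • M).det) M.trace 0 := by
  rw [funext fun t => det_one_add_smul t M]
  set p := (1 + (Polynomial.X : Polynomial 𝕜) • M.map Polynomial.C).det.divX.divX
  simpa using (((hasDerivAt_id (0 : 𝕜)).const_mul M.trace).const_add 1).fun_add
    ((p.hasDerivAt 0).fun_mul (hasDerivAt_pow 2 (0 : 𝕜)))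

/-- **Jacobi's formula** at an invertible matrix. -/
theorem hasDerivAt_det_add_smul {𝕜 : Type*} [NontriviallyNormedField 𝕜] {A : Matrix n n 𝕜}
    (hA : IsUnit A.det) (M : Matrix n n 𝕜) :
    HasDerivAt (fun t : 𝕜 => (A + t • M).det) (A.det * (A⁻¹ * M).trace) 0 := by
  have hfactor (t : 𝕜) : A + t • M = A * (1 + t • (A⁻¹ * M)) := by
    rw [Matrix.mul_add, Matrix.mul_one, Matrix.mul_smul, mul_nonsing_inv_cancel_left _ _ hA]
  simp only [hfactor, det_mul]
  exact (hasDerivAt_det_one_add_smul (A⁻¹ * M)).const_mul A.det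

theorem det_le_exp_trace_sub_card {M : Matrix n n ℝ} (hM : M.PosSemidef) :
    M.det ≤ Real.exp (M.trace - Fintype.card n) := by
  set x := hM.isHermitian.eigenvalues
  calc M.det = ∏ i, x i := hM.isHermitian.det_eq_prod_eigenvalues
    _ ≤ ∏ i, Real.exp (x i - 1) :=
      Finset.prod_le_prod (fun i _ => hM.eigenvalues_nonneg i) fun i _ => by
        linarith [Real.add_one_le_exp (x i - 1)]
    _ = Real.exp (M.trace - Fintype.card n) := by
      rw [← Real.exp_sum, hM.isHermitian.trace_eq_sum_eigenvalues]
      simp [x]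

open scoped MatrixOrder in
theorem det_le_det_mul_exp_trace {A X : Matrix n n ℝ} (hA : A.PosDef) (hX : X.PosSemidef) :
    X.det ≤ A.det * Real.exp (A⁻¹ * (X - A)).trace := by
  obtain ⟨S, hS⟩ := CStarAlgebra.nonneg_iff_eq_star_mul_self.mp hA.inv.posSemidef.nonneg
  have hAdet : IsUnit A.det := hA.det_pos.ne'.isUnit
  have hdet : (S * X * star S).det = A.det⁻¹ * X.det := by
    rw [← Ring.inverse_eq_inv', ← det_nonsing_inv, hS, det_mul, det_mul, det_mul]
    ring
  have htrace : (S * X * star S).trace - Fintype.card n = (A⁻¹ * (X - A)).trace := by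
    rw [trace_mul_comm, ← Matrix.mul_assoc, ← hS, Matrix.mul_sub, nonsing_inv_mul _ hAdet,
      trace_sub, trace_one]
  have hle := det_le_exp_trace_sub_card (hX.mul_mul_conjTranspose_same S)
  rwa [← star_eq_conjTranspose, hdet, htrace, inv_mul_le_iff₀ hA.det_pos] at hle

end Determinants

/-! ### Spanning subgraphs as sets of edges -/

section EdgeSubgraph

variable {V : Type*} (G : SimpleGraph V)

/-- The spanning subgraph of `G` with edge set `s`. It identifies the spanning trees of `G` with
the sets of edges occurring in the Cauchy–Binet expansion. -/
def edgeSubgraph (s : Set G.edgeSet) : SimpleGraph V :=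
  SimpleGraph.fromEdgeSet (Subtype.val '' s)

variable {G}

theorem edgeSubgraph_adj {s : Set G.edgeSet} {v w : V} :
    (edgeSubgraph G s).Adj v w ↔ ∃ h : G.Adj v w, ⟨s(v, w), h⟩ ∈ s := by
  rw [edgeSubgraph, SimpleGraph.fromEdgeSet_adj]
  constructor
  · rintro ⟨⟨⟨e, he⟩, hes, rfl⟩, -⟩
    exact ⟨he, hes⟩
  · rintro ⟨h, hs⟩
    exact ⟨⟨_, hs, rfl⟩, h.ne⟩

theorem mem_edgeSet_edgeSubgraph {s : Set G.edgeSet} {e : G.edgeSet} :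
    e.1 ∈ (edgeSubgraph G s).edgeSet ↔ e ∈ s := by
  obtain ⟨⟨v, w⟩, h⟩ := e
  exact edgeSubgraph_adj.trans (exists_prop_of_true h)

theorem edgeSubgraph_le (s : Set G.edgeSet) : edgeSubgraph G s ≤ G :=
  fun _ _ h => (edgeSubgraph_adj.1 h).1

theorem edgeSubgraph_setOf_mem_edgeSet {S : SimpleGraph V} (hS : S ≤ G) :
    edgeSubgraph G {e | e.1 ∈ S.edgeSet} = S := by
  ext v w
  exact edgeSubgraph_adj.trans ⟨fun ⟨_, h⟩ => h, fun h => ⟨hS h, h⟩⟩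

theorem card_edgeSet_edgeSubgraph (s : Finset G.edgeSet) :
    Nat.card (edgeSubgraph G s).edgeSet = s.card := by
  have himage : (edgeSubgraph G s).edgeSet = Subtype.val '' (s : Set G.edgeSet) := by
    ext e
    constructor
    · intro he
      have heG : e ∈ G.edgeSet := SimpleGraph.edgeSet_mono (edgeSubgraph_le _) he
      exact ⟨⟨e, heG⟩, mem_edgeSet_edgeSubgraph.1 he, rfl⟩
    · rintro ⟨e, he, rfl⟩
      exact mem_edgeSet_edgeSubgraph.2 he
  rw [himage, Nat.card_image_of_injective Subtype.val_injective, Nat.card_coe_set_eq,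
    Set.ncard_coe_finset]

variable [Fintype V]

theorem isTree_edgeSubgraph_iff {n : ℕ} (hn : n + 1 = Fintype.card V) (s : Finset G.edgeSet) :
    (edgeSubgraph G s).IsTree ↔ (edgeSubgraph G s).Connected ∧ s.card = n := by
  rw [SimpleGraph.isTree_iff_connected_and_card, card_edgeSet_edgeSubgraph,
    Nat.card_eq_fintype_card, ← hn, add_left_inj]

variable [DecidableEq V] [DecidableRel G.Adj]

open Classical in
theorem sum_spanningTrees {M : Type*} [AddCommMonoid M] {n : ℕ} (hn : n + 1 = Fintype.card V)
    (F : Finset G.edgeSet → M) :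
    ∑ S ∈ spanningTrees G, F {e : G.edgeSet | e.1 ∈ S.edgeSet} =
      ∑ s ∈ (Finset.univ : Finset G.edgeSet).powersetCard n,
        if (edgeSubgraph G s).Connected then F s else 0 := by
  have hleft (S : SimpleGraph V) (hS : S ≤ G) :
      edgeSubgraph G (({e : G.edgeSet | e.1 ∈ S.edgeSet} : Finset G.edgeSet) : Set G.edgeSet) =
        S := by
    rw [Finset.coe_filter_univ, edgeSubgraph_setOf_mem_edgeSet hS]
  have hright (s : Finset G.edgeSet) :
      ({e : G.edgeSet | e.1 ∈ (edgeSubgraph G (s : Set G.edgeSet)).edgeSet} : Finset G.edgeSet) =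
        s := by
    ext e
    simp only [Finset.mem_filter_univ, mem_edgeSet_edgeSubgraph, Finset.mem_coe]
  rw [← Finset.sum_filter]
  refine Finset.sum_nbij' (fun S => ({e : G.edgeSet | e.1 ∈ S.edgeSet} : Finset G.edgeSet))
    (fun s : Finset G.edgeSet => edgeSubgraph G s) ?_ ?_ ?_ (fun s _ => hright s) fun _ _ => rfl
  · intro S hS
    obtain ⟨hle, htree⟩ := (Finset.mem_filter_univ S).1 hS
    rw [← hleft S hle, isTree_edgeSubgraph_iff hn] at htree
    simpa [Finset.mem_powersetCard, and_comm] using htree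
  · intro s hs
    simp only [Finset.mem_filter, Finset.mem_powersetCard_univ] at hs
    exact (Finset.mem_filter_univ _).2
      ⟨edgeSubgraph_le _, (isTree_edgeSubgraph_iff hn s).2 hs.symm⟩
  · intro S hS
    exact hleft S ((Finset.mem_filter_univ S).1 hS).1

end EdgeSubgraph

/-! ### The matrix-tree theorem -/

section MatrixTree

variable {V : Type*} [DecidableEq V] (G : SimpleGraph V)

/-- The unit vector at `w`, or zero if `w = r`: the coordinate at `r` is dropped. -/
def reducedSingle (r w : V) : {v // v ≠ r} → ℤ :=
  fun u => Pi.single (M := fun _ => ℤ) w 1 u.1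

/-- The signed incidence matrix of `G` with the column of the vertex `r` removed; rows are indexed
by edges, each of which is oriented arbitrarily by `Quot.out`. -/
noncomputable def reducedIncidence (r : V) : Matrix G.edgeSet {v // v ≠ r} ℤ :=
  .of fun e => reducedSingle r (Quot.out e.1).1 - reducedSingle r (Quot.out e.1).2

variable {G}

theorem reducedSingle_self (r : V) : reducedSingle r r = 0 :=
  funext fun u => Pi.single_eq_of_ne u.2 1

theorem reducedSingle_coe {r : V} (u : {v // v ≠ r}) : reducedSingle r u = Pi.single u 1 := by
  ext u'
  simp only [reducedSingle, Pi.single_apply, Subtype.ext_iff]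

theorem reducedSingle_dotProduct [Fintype V] {r : V} (w : V) {x : V → ℤ} (hx : x r = 0) :
    (reducedSingle r w ⬝ᵥ fun u => x u) = x w := by
  rcases eq_or_ne w r with rfl | hw
  · rw [reducedSingle_self, zero_dotProduct, hx]
  · rw [reducedSingle_coe ⟨w, hw⟩, single_one_dotProduct]

theorem reducedIncidence_mk (r : V) {v w : V} (h : G.Adj v w) :
    (reducedIncidence G r).row ⟨s(v, w), h⟩ = reducedSingle r v - reducedSingle r w ∨
      (reducedIncidence G r).row ⟨s(v, w), h⟩ = -(reducedSingle r v - reducedSingle r w) := by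
  have hout : s((Quot.out s(v, w)).1, (Quot.out s(v, w)).2) = s(v, w) := Quot.out_eq _
  have hrow : (reducedIncidence G r).row ⟨s(v, w), h⟩ =
      reducedSingle r (Quot.out s(v, w)).1 - reducedSingle r (Quot.out s(v, w)).2 := rfl
  rcases Sym2.eq_iff.1 hout with ⟨hv, hw⟩ | ⟨hv, hw⟩
  · exact .inl (by rw [hrow, hv, hw])
  · exact .inr (by rw [hrow, hv, hw, neg_sub])

theorem reducedSingle_sub_mem_span (r : V) {s : Set G.edgeSet} {v w : V}
    (h : (edgeSubgraph G s).Reachable v w) :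
    reducedSingle r v - reducedSingle r w ∈ Submodule.span ℤ ((reducedIncidence G r).row '' s) := by
  obtain ⟨p⟩ := h
  induction p with
  | nil => simp
  | @cons a b c hab _ ih =>
    obtain ⟨hG, hs⟩ := edgeSubgraph_adj.1 hab
    have hrow := Submodule.subset_span (R := ℤ) (Set.mem_image_of_mem (reducedIncidence G r).row hs)
    have hfirst : reducedSingle r a - reducedSingle r b ∈
        Submodule.span ℤ ((reducedIncidence G r).row '' s) := by
      rcases reducedIncidence_mk r hG with hsign | hsign <;> rw [hsign] at hrow
      exacts [hrow, neg_mem_iff.1 hrow]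
    simpa using add_mem hfirst ih

theorem span_reducedIncidence_eq_top (r : V) [Finite V] {s : Set G.edgeSet}
    (hs : (edgeSubgraph G s).Connected) :
    Submodule.span ℤ ((reducedIncidence G r).row '' s) = ⊤ := by
  rw [eq_top_iff, ← (Pi.basisFun ℤ {v // v ≠ r}).span_eq, Submodule.span_le]
  rintro _ ⟨u, rfl⟩
  simpa [reducedSingle_self, reducedSingle_coe] using
    reducedSingle_sub_mem_span r (hs.preconnected u.1 r)

variable [Fintype V]

theorem exists_reducedIncidence_dotProduct_eq_zero (r : V) {s : Set G.edgeSet}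
    (hs : ¬ (edgeSubgraph G s).Connected) :
    ∃ x ≠ 0, ∀ e ∈ s, (reducedIncidence G r).row e ⬝ᵥ x = 0 := by
  -- `x` is the indicator of the vertices which are not reachable from `r`.
  classical
  obtain ⟨w, hw⟩ : ∃ w, ¬ (edgeSubgraph G s).Reachable r w := by
    by_contra! hreach
    exact hs ((SimpleGraph.connected_iff_exists_forall_reachable _).2 ⟨r, hreach⟩)
  set x : V → ℤ := fun v => if (edgeSubgraph G s).Reachable r v then 0 else 1 with hx
  have hxr : x r = 0 := if_pos (SimpleGraph.Reachable.refl r)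
  refine ⟨fun u => x u, fun hzero => ?_, ?_⟩
  · have hwr : w ≠ r := fun h => hw (h ▸ SimpleGraph.Reachable.refl w)
    exact one_ne_zero ((if_neg hw).symm.trans (congrFun hzero ⟨w, hwr⟩))
  · rintro ⟨⟨a, b⟩, hG⟩ hes
    have hadj : (edgeSubgraph G s).Adj a b := edgeSubgraph_adj.2 ⟨hG, hes⟩
    have hreach : (edgeSubgraph G s).Reachable r a ↔ (edgeSubgraph G s).Reachable r b :=
      ⟨fun h => h.trans hadj.reachable, fun h => h.trans hadj.symm.reachable⟩
    have hconst : x a = x b := by simp only [hx, hreach]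
    change (reducedIncidence G r).row ⟨s(a, b), hG⟩ ⬝ᵥ _ = 0
    rcases reducedIncidence_mk r hG with hsign | hsign <;> rw [hsign] <;>
      simp [sub_dotProduct, reducedSingle_dotProduct _ hxr, hconst]

open Classical in
theorem det_reducedIncidence_sq (r : V) {s : Finset G.edgeSet} (e : {v // v ≠ r} ≃ s) :
    ((reducedIncidence G r).submatrix (fun u => (e u).1) id).det ^ 2 =
      if (edgeSubgraph G s).Connected then 1 else 0 := by
  set M := (reducedIncidence G r).submatrix (fun u => (e u).1) id
  split_ifs with hs
  · have hrows : Set.range M.row = (reducedIncidence G r).row '' s := by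
      rw [Set.image_eq_range]
      exact e.surjective.range_comp fun i : s => (reducedIncidence G r).row i
    have hunit : IsUnit M := by
      rw [← vecMul_surjective_iff_isUnit, ← coe_vecMulLinear, ← LinearMap.range_eq_top,
        range_vecMulLinear, hrows, span_reducedIncidence_eq_top r hs]
    exact Int.isUnit_sq ((isUnit_iff_isUnit_det M).1 hunit)
  · obtain ⟨x, hx, hker⟩ := exists_reducedIncidence_dotProduct_eq_zero r hs
    have hdet : M.det = 0 :=
      exists_mulVec_eq_zero_iff.1 ⟨x, hx, funext fun u => hker _ (e u).2⟩
    rw [hdet, zero_pow two_ne_zero]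

open Classical in
theorem det_reducedIncidence_mul_transpose (r : V) {s : Finset G.edgeSet}
    (hs : s.card = Fintype.card {v // v ≠ r}) :
    ((reducedIncidence G r * (reducedIncidence G r)ᵀ).submatrix
      (Subtype.val : s → G.edgeSet) Subtype.val).det =
        if (edgeSubgraph G s).Connected then 1 else 0 := by
  have e : {v // v ≠ r} ≃ s := Fintype.equivOfCardEq (by rw [← hs, Fintype.card_coe])
  set M := (reducedIncidence G r).submatrix (fun u => (e u).1) id
  have hminor : ((reducedIncidence G r * (reducedIncidence G r)ᵀ).submatrix
      (Subtype.val : s → G.edgeSet) Subtype.val).submatrix e e = M * Mᵀ := rfl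
  rw [← det_submatrix_equiv_self e, hminor, det_mul, det_transpose, ← sq,
    det_reducedIncidence_sq r e]

variable [DecidableRel G.Adj] {R : Type*} [CommRing R]

variable (G) in
/-- The weighted Laplacian matrix of `G` with the row and the column of the vertex `r` removed, as
a linear function of the weights. It is given by its factorization through the signed incidence
matrix, to which the Cauchy–Binet formula applies. -/
noncomputable def reducedLaplacian (r : V) :
    (G.edgeSet → R) →ₗ[R] Matrix {v // v ≠ r} {v // v ≠ r} R where
  toFun f := ((reducedIncidence G r).map (Int.cast : ℤ → R))ᵀ *
    (diagonal f * (reducedIncidence G r).map (Int.cast : ℤ → R))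
  map_add' f g := by
    rw [← Matrix.mul_add, ← Matrix.add_mul, diagonal_add]
    rfl
  map_smul' t f := by
    rw [diagonal_smul, Matrix.smul_mul, Matrix.mul_smul, RingHom.id_apply]

open Classical in
theorem det_diagonal_mul_reducedIncidence_mul_transpose (r : V) (f : G.edgeSet → R)
    {s : Finset G.edgeSet} (hs : s.card = Fintype.card {v // v ≠ r}) :
    ((diagonal f * (reducedIncidence G r).map (Int.cast : ℤ → R) *
      ((reducedIncidence G r).map (Int.cast : ℤ → R))ᵀ).submatrix
        (Subtype.val : s → G.edgeSet) (Subtype.val : s → G.edgeSet)).det =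
      if (edgeSubgraph G s).Connected then ∏ e ∈ s, f e else 0 := by
  have hfactor : (diagonal f * (reducedIncidence G r).map (Int.cast : ℤ → R) *
      ((reducedIncidence G r).map (Int.cast : ℤ → R))ᵀ).submatrix
        (Subtype.val : s → G.edgeSet) (Subtype.val : s → G.edgeSet) =
      diagonal (fun e : s => f e) *
        ((reducedIncidence G r * (reducedIncidence G r)ᵀ).submatrix
          (Subtype.val : s → G.edgeSet) (Subtype.val : s → G.edgeSet)).map (Int.cast : ℤ → R) := by
    ext i j
    rw [submatrix_apply, Matrix.mul_assoc, diagonal_mul, diagonal_mul]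
    simp [mul_apply]
  rw [hfactor, det_mul, det_diagonal, ← Int.cast_det, det_reducedIncidence_mul_transpose r hs,
    Finset.prod_coe_sort s f]
  split_ifs <;> simp

open Classical in
/-- The weighted **matrix-tree theorem**. -/
theorem det_reducedLaplacian (r : V) (f : G.edgeSet → R) :
    (reducedLaplacian G r f).det =
      ∑ S ∈ spanningTrees G, ∏ e : G.edgeSet with e.1 ∈ S.edgeSet, f e := by
  have hcard : Fintype.card {v // v ≠ r} + 1 = Fintype.card V := by
    rw [Fintype.card_subtype_compl, Fintype.card_subtype_eq]
    exact Nat.sub_add_cancel (Fintype.card_pos_iff.2 ⟨r⟩)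
  rw [sum_spanningTrees hcard fun s => ∏ e ∈ s, f e]
  exact (det_mul_eq_sum_det_submatrix _ _).trans <| Finset.sum_congr rfl fun s hs =>
    det_diagonal_mul_reducedIncidence_mul_transpose r f (Finset.mem_powersetCard_univ.1 hs)

end MatrixTree

/-! ### Maximizing the number of spanning trees -/

section Maximization

theorem eventually_pos_add_smul {ι : Type*} [Finite ι] {f : ι → ℝ} (hf : ∀ i, 0 < f i)
    (d : ι → ℝ) : ∀ᶠ t in 𝓝 (0 : ℝ), ∀ i, 0 < (f + t • d) i := by
  refine Filter.eventually_all.2 fun i => ?_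
  have hcont : Continuous fun t : ℝ => (f + t • d) i :=
    continuous_const.add (continuous_id.mul continuous_const)
  exact hcont.continuousAt.eventually (lt_mem_nhds (by simpa using hf i))

variable {V : Type*} [Fintype V] {G : SimpleGraph V} [DecidableRel G.Adj] {f f' : G.edgeSet → ℝ}

theorem eventually_add_smul_mem_P {d : G.edgeSet → ℝ} (hf : f ∈ P G) (hd : ∑ e, d e = 0) :
    ∀ᶠ t in 𝓝 (0 : ℝ), f + t • d ∈ P G := by
  filter_upwards [eventually_pos_add_smul hf.1 d] with t ht
  refine ⟨ht, ?_⟩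
  simp [Finset.sum_add_distrib, ← Finset.mul_sum, hd, hf.2]

variable [DecidableEq V]

theorem posSemidef_reducedLaplacian (r : V) (hf : ∀ e, 0 ≤ f e) :
    (reducedLaplacian G r f).PosSemidef := by
  have hdiag : (diagonal f).PosSemidef := PosSemidef.diagonal hf
  have hconj := hdiag.conjTranspose_mul_mul_same ((reducedIncidence G r).map (Int.cast : ℤ → ℝ))
  rwa [conjTranspose_eq_transpose_of_trivial, Matrix.mul_assoc] at hconj

theorem hasDerivAt_treeNumber (f d : G.edgeSet → ℝ) :
    HasDerivAt (fun t : ℝ => treeNumber G (f + t • d)) (d ⬝ᵥ edgeTreeNumber G f) 0 := by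
  classical
  have hcoord (e : G.edgeSet) : HasDerivAt (fun t : ℝ => (f + t • d) e) (d e) 0 := by
    simpa using ((hasDerivAt_id (0 : ℝ)).mul_const (d e)).const_add (f e)
  have hleibniz := HasDerivAt.fun_sum (u := spanningTrees G) fun S _ =>
    HasDerivAt.fun_finsetProd (u := {e : G.edgeSet | e.1 ∈ S.edgeSet}) fun e _ => hcoord e
  refine hleibniz.congr_deriv ?_
  simp only [dotProduct, edgeTreeNumber, Finset.mul_sum, Finset.sum_filter, zero_smul, add_zero,
    smul_eq_mul]
  rw [Finset.sum_comm]
  refine Finset.sum_congr rfl fun e _ => Finset.sum_congr rfl fun S _ => ?_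
  have herase : ({k : G.edgeSet | k.1 ∈ S.edgeSet} : Finset G.edgeSet).erase e =
      ({k : G.edgeSet | k.1 ∈ S.edgeSet ∧ k ≠ e} : Finset G.edgeSet) := by
    ext k
    simp [and_comm]
  split_ifs
  · rw [herase, mul_comm]
  · rw [mul_zero]

theorem treeNumber_le_mul_exp (hf : ∀ e, 0 < f e) (hf' : ∀ e, 0 ≤ f' e) :
    treeNumber G f' ≤
      treeNumber G f * Real.exp (((f' - f) ⬝ᵥ edgeTreeNumber G f) / treeNumber G f) := by
  classical
  rcases (spanningTrees G).eq_empty_or_nonempty with hempty | hne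
  · simp [treeNumber, hempty]
  have hpos : 0 < treeNumber G f :=
    Finset.sum_pos (fun S _ => Finset.prod_pos fun e _ => hf e) hne
  obtain ⟨S, hS⟩ := hne
  obtain ⟨r⟩ := ((Finset.mem_filter_univ S).1 hS).2.connected.nonempty
  set L := reducedLaplacian (R := ℝ) G r
  have hdet (x : G.edgeSet → ℝ) : treeNumber G x = (L x).det := (det_reducedLaplacian r x).symm
  have hL : (L f).PosDef :=
    (posSemidef_reducedLaplacian r fun e => (hf e).le).posDef_iff_det_ne_zero.2 (hdet f ▸ hpos.ne')
  have hderiv := hasDerivAt_treeNumber f (f' - f)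
  simp only [hdet, map_add, map_smul, map_sub] at hderiv
  have htrace : ((L f)⁻¹ * (L f' - L f)).trace = ((f' - f) ⬝ᵥ edgeTreeNumber G f) / (L f).det :=
    eq_div_of_mul_eq hL.det_pos.ne' <|
      (mul_comm _ _).trans ((hasDerivAt_det_add_smul hL.det_pos.ne'.isUnit _).unique hderiv)
  rw [hdet, hdet, ← htrace]
  exact det_le_det_mul_exp_trace hL (posSemidef_reducedLaplacian r hf')

theorem dotProduct_edgeTreeNumber_eq_zero {A : Set (G.edgeSet → ℝ)} {d : G.edgeSet → ℝ}
    (hmax : IsMaxOn (treeNumber G) A f) (hd : ∀ᶠ t in 𝓝 (0 : ℝ), f + t • d ∈ A) :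
    d ⬝ᵥ edgeTreeNumber G f = 0 := by
  have hloc : IsLocalMax (fun t : ℝ => treeNumber G (f + t • d)) 0 := by
    filter_upwards [hd] with t ht
    simpa using hmax ht
  exact hloc.hasDerivAt_eq_zero (hasDerivAt_treeNumber f d)

theorem isMaxOn_treeNumber_iff {A D : Set (G.edgeSet → ℝ)} (hA : ∀ x ∈ A, ∀ e, 0 < x e)
    (hf : f ∈ A) (hsub : ∀ f' ∈ A, f' - f ∈ D)
    (hopen : ∀ d ∈ D, ∀ᶠ t in 𝓝 (0 : ℝ), f + t • d ∈ A) :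
    IsMaxOn (treeNumber G) A f ↔ ∀ d ∈ D, d ⬝ᵥ edgeTreeNumber G f = 0 := by
  refine ⟨fun hmax d hd => dotProduct_edgeTreeNumber_eq_zero hmax (hopen d hd),
    fun hcrit f' hf' => ?_⟩
  have hle := treeNumber_le_mul_exp (hA f hf) fun e => (hA f' hf' e).le
  rwa [hcrit _ (hsub f' hf'), zero_div, Real.exp_zero, mul_one] at hle

end Maximization

/-! ### Orthogonality criteria -/

section Orthogonality

variable {m n K : Type*} [Fintype m] [Fintype n] [Field K]

theorem forall_mulVec_eq_zero_imp_dotProduct_eq_zero_iff {B : Matrix m n K} {y : n → K} :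
    (∀ d, B *ᵥ d = 0 → d ⬝ᵥ y = 0) ↔ ∃ l, y = l ᵥ* B := by
  constructor
  · intro h
    have hspan : dotProductBilin K K y ∈
        Submodule.span K (Set.range fun i => dotProductBilin K K (B.row i)) := by
      refine FiniteDimensional.mem_span_of_iInf_ker_le_ker fun d hd => ?_
      simp only [Submodule.mem_iInf, LinearMap.mem_ker, dotProductBilin_apply_apply] at hd ⊢
      rw [dotProduct_comm]
      exact h d (funext hd)
    obtain ⟨l, hl⟩ := (Submodule.mem_span_range_iff_exists_fun K).1 hspan
    refine ⟨l, dotProduct_eq _ _ fun d => ?_⟩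
    have happly : ∑ i, l i * (B.row i ⬝ᵥ d) = y ⬝ᵥ d := by
      simpa using LinearMap.congr_fun hl d
    exact happly.symm.trans (dotProduct_mulVec l B d)
  · rintro ⟨l, rfl⟩ d hd
    rw [dotProduct_comm, ← dotProduct_mulVec, hd, dotProduct_zero]

theorem forall_dotProduct_eq_zero_imp_iff {x y : n → K} (hxy : x = 0 → y = 0) :
    (∀ a, a ⬝ᵥ x = 0 → a ⬝ᵥ y = 0) ↔ ∀ v w, x w * y v = x v * y w := by
  classical
  constructor
  · intro h v w
    have horth : (Pi.single v (x w) - Pi.single w (x v)) ⬝ᵥ x = 0 := by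
      rw [sub_dotProduct, single_dotProduct, single_dotProduct, mul_comm, sub_self]
    simpa [sub_dotProduct, sub_eq_zero] using h _ horth
  · intro h a ha
    rcases eq_or_ne x 0 with hx | hx
    · rw [hxy hx, dotProduct_zero]
    obtain ⟨w, hw⟩ := Function.ne_iff.1 hx
    have hprop : x w • y = y w • x := funext fun v => (h v w).trans (mul_comm _ _)
    refine (mul_eq_zero.1 ?_).resolve_left hw
    rw [← smul_eq_mul, ← dotProduct_smul, hprop, dotProduct_smul, ha, smul_zero]

end Orthogonality

/-! ### The conditions defining `T(G)` and `C(G)` -/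

section Incidence

variable {V : Type*} [DecidableEq V] (G : SimpleGraph V) [DecidableRel G.Adj]

/-- The unoriented incidence matrix of `G`, with columns indexed by the edges of `G` only, as
valuations are. -/
def edgeIncMatrix (R : Type*) [Zero R] [One R] : Matrix V G.edgeSet R :=
  (G.incMatrix R).submatrix id Subtype.val

variable {G} {R : Type*} [Semiring R]

theorem edgeIncMatrix_apply (v : V) (e : G.edgeSet) :
    edgeIncMatrix G R v e = if v ∈ e.1 then 1 else 0 := by
  have hmem : e.1 ∈ G.incidenceSet v ↔ v ∈ e.1 := and_iff_right e.2
  simp only [edgeIncMatrix, submatrix_apply, id, SimpleGraph.incMatrix_apply', hmem]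

variable [Fintype V]

theorem edgeIncMatrix_mulVec (x : G.edgeSet → R) (v : V) :
    (edgeIncMatrix G R *ᵥ x) v = ∑ e : G.edgeSet with v ∈ e.1, x e := by
  simp [mulVec, dotProduct, edgeIncMatrix_apply, Finset.sum_filter]

theorem vecMul_edgeIncMatrix (a : V → R) {v w : V} (h : G.Adj v w) :
    (a ᵥ* edgeIncMatrix G R) ⟨s(v, w), h⟩ = a v + a w := by
  have hends : ({u | u ∈ s(v, w)} : Finset V) = {v, w} := by
    ext u
    simp
  simp only [vecMul, dotProduct, edgeIncMatrix_apply, mul_ite, mul_one, mul_zero,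
    ← Finset.sum_filter, hends, Finset.sum_pair h.ne]

theorem eq_vecMul_edgeIncMatrix_iff {x : G.edgeSet → R} {a : V → R} :
    x = a ᵥ* edgeIncMatrix G R ↔
      ∀ (v w : V) (h : G.Adj v w), x ⟨s(v, w), h⟩ = a v + a w := by
  refine ⟨fun hx v w h => hx ▸ vecMul_edgeIncMatrix a h, fun hx => ?_⟩
  ext ⟨⟨v, w⟩, h⟩
  exact (hx v w h).trans (vecMul_edgeIncMatrix a h).symm

theorem edgeIncMatrix_mulVec_one : edgeIncMatrix G R *ᵥ 1 = fun v => (G.degree v : R) := by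
  ext v
  simp only [edgeIncMatrix_mulVec, Finset.sum_filter, Pi.one_apply]
  rw [Finset.sum_set_coe G.edgeSet (f := fun e => if v ∈ e then (1 : R) else 0), Finset.sum_boole,
    ← G.card_incidenceFinset_eq_degree, G.incidenceFinset_eq_filter]
  rfl

theorem edgeIncMatrix_mulVec_apply_eq_zero {v : V} (hv : G.degree v = 0) (x : G.edgeSet → R) :
    (edgeIncMatrix G R *ᵥ x) v = 0 := by
  rw [← G.card_incidenceFinset_eq_degree, Finset.card_eq_zero] at hv
  refine (edgeIncMatrix_mulVec x v).trans (Finset.sum_eq_zero fun e he => ?_)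
  have hmem : e.1 ∈ G.incidenceFinset v :=
    (G.mem_incidenceFinset v e.1).2 ⟨e.2, (Finset.mem_filter_univ e).1 he⟩
  simp [hv] at hmem

theorem sum_vecMul_edgeIncMatrix (a : V → R) :
    ∑ e, (a ᵥ* edgeIncMatrix G R) e = a ⬝ᵥ fun v => (G.degree v : R) := by
  rw [← edgeIncMatrix_mulVec_one, dotProduct_mulVec, dotProduct_one]

theorem sum_edgeIncMatrix_mulVec (x : G.edgeSet → R) :
    ∑ v, (edgeIncMatrix G R *ᵥ x) v = 2 * ∑ e, x e := by
  have htwo : (2 : G.edgeSet → R) = 1 ᵥ* edgeIncMatrix G R :=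
    eq_vecMul_edgeIncMatrix_iff.2 fun _ _ _ => one_add_one_eq_two.symm
  rw [← one_dotProduct, dotProduct_mulVec, ← htwo, Finset.mul_sum]
  rfl

theorem mem_T_iff {f : G.edgeSet → ℝ} :
    f ∈ T G ↔ f ∈ P G ∧ edgeIncMatrix G ℝ *ᵥ f = fun v => (G.degree v : ℝ) := by
  simp only [T, Set.mem_ofPred_eq, funext_iff, edgeIncMatrix_mulVec]

theorem mem_C_iff {f : G.edgeSet → ℝ} :
    f ∈ C G ↔ f ∈ P G ∧ ∃ g : V → ℝ, (∀ v, 0 < g v) ∧ f = g ᵥ* edgeIncMatrix G ℝ := by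
  simp only [C, Set.mem_ofPred_eq, eq_vecMul_edgeIncMatrix_iff]

theorem isMaxOn_T_iff {f : G.edgeSet → ℝ} (hf : f ∈ T G) :
    IsMaxOn (treeNumber G) (T G) f ↔
      ∃ l : V → ℝ, ∀ (v w : V) (h : G.Adj v w), edgeTreeNumber G f ⟨s(v, w), h⟩ = l v + l w := by
  have hfT := mem_T_iff.1 hf
  calc
    _ ↔ ∀ d, edgeIncMatrix G ℝ *ᵥ d = 0 → d ⬝ᵥ edgeTreeNumber G f = 0 := by
      refine isMaxOn_treeNumber_iff (D := {d | edgeIncMatrix G ℝ *ᵥ d = 0}) (fun _ h => h.1.1) hf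
        (fun f' hf' => ?_) fun d hd => ?_
      · rw [Set.mem_ofPred_eq, mulVec_sub, (mem_T_iff.1 hf').2, hfT.2, sub_self]
      · have hsum : ∑ e, d e = 0 := by
          simpa [hd.out] using sum_edgeIncMatrix_mulVec d
        filter_upwards [eventually_add_smul_mem_P hf.1 hsum] with t ht
        refine mem_T_iff.2 ⟨ht, ?_⟩
        rw [mulVec_add, mulVec_smul, hd.out, smul_zero, add_zero, hfT.2]
    _ ↔ ∃ l, edgeTreeNumber G f = l ᵥ* edgeIncMatrix G ℝ :=
      forall_mulVec_eq_zero_imp_dotProduct_eq_zero_iff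
    _ ↔ _ := by simp only [eq_vecMul_edgeIncMatrix_iff]

theorem isMaxOn_C_iff {f : G.edgeSet → ℝ} (hf : f ∈ C G) :
    IsMaxOn (treeNumber G) (C G) f ↔
      ∀ v w : V,
        (G.degree w : ℝ) * ∑ e : G.edgeSet with v ∈ e.1, edgeTreeNumber G f e =
          (G.degree v : ℝ) * ∑ e : G.edgeSet with w ∈ e.1, edgeTreeNumber G f e := by
  obtain ⟨hfP, g, hg, hfg⟩ := mem_C_iff.1 hf
  calc
    _ ↔ ∀ d ∈ (· ᵥ* edgeIncMatrix G ℝ) '' {a | (a ⬝ᵥ fun v => (G.degree v : ℝ)) = 0},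
        d ⬝ᵥ edgeTreeNumber G f = 0 := by
      refine isMaxOn_treeNumber_iff (fun _ h => h.1.1) hf ?_ ?_
      · rintro f' hf'
        obtain ⟨hfP', g', -, hfg'⟩ := mem_C_iff.1 hf'
        refine ⟨g' - g, ?_, ?_⟩
        · rw [Set.mem_ofPred_eq, sub_dotProduct, ← sum_vecMul_edgeIncMatrix,
            ← sum_vecMul_edgeIncMatrix, ← hfg, ← hfg', hfP.2, hfP'.2, sub_self]
        · exact (sub_vecMul _ _ _).trans (by rw [hfg, hfg'])
      · rintro _ ⟨a, ha, rfl⟩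
        have hsum := (sum_vecMul_edgeIncMatrix a).trans ha
        filter_upwards [eventually_add_smul_mem_P hfP hsum, eventually_pos_add_smul hg a]
          with t htP htpos
        refine mem_C_iff.2 ⟨htP, g + t • a, htpos, ?_⟩
        rw [add_vecMul, smul_vecMul, hfg]
    _ ↔ ∀ a, (a ⬝ᵥ fun v => (G.degree v : ℝ)) = 0 →
        a ⬝ᵥ (edgeIncMatrix G ℝ *ᵥ edgeTreeNumber G f) = 0 := by
      simp only [Set.forall_mem_image, Set.mem_ofPred_eq, dotProduct_mulVec]
    _ ↔ _ := by
      have hzero (hdeg : (fun v => (G.degree v : ℝ)) = 0) :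
          edgeIncMatrix G ℝ *ᵥ edgeTreeNumber G f = 0 :=
        funext fun v => edgeIncMatrix_mulVec_apply_eq_zero (Nat.cast_eq_zero.1 (congrFun hdeg v)) _
      rw [forall_dotProduct_eq_zero_imp_iff hzero]
      simp only [edgeIncMatrix_mulVec]

end Incidence

end EdgeValuation

theorem theorem8 {V : Type*} [Fintype V] [DecidableEq V] (G : SimpleGraph V)
    [DecidableRel G.Adj] :
    (∀ f ∈ EdgeValuation.T G,
      (IsMaxOn (EdgeValuation.treeNumber G) (EdgeValuation.T G) f ↔
        ∃ l : V → ℝ, ∀ (v w : V) (h : G.Adj v w),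
          EdgeValuation.edgeTreeNumber G f ⟨s(v, w), h⟩ = l v + l w)) ∧
    (∀ f ∈ EdgeValuation.C G,
      (IsMaxOn (EdgeValuation.treeNumber G) (EdgeValuation.C G) f ↔
        ∀ v w : V,
          (G.degree w : ℝ) * ∑ e : G.edgeSet with v ∈ e.1, EdgeValuation.edgeTreeNumber G f e =
            (G.degree v : ℝ) *
              ∑ e : G.edgeSet with w ∈ e.1, EdgeValuation.edgeTreeNumber G f e)) :=
  ⟨fun _ hf => EdgeValuation.isMaxOn_T_iff hf, fun _ hf => EdgeValuation.isMaxOn_C_iff hf⟩
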